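/- A Hausdorff group topology on an Abelian group $G$ is called minimally almost periodic (MinAP) if every continuous character of $G$, i.e. every continuous homomorphism from $G$ to the circle group $\mathbb{T}$, is trivial; equivalently, if the von Neumann radical (the intersection of the kernels of all continuous characters) is all of $G$. Every Abelian group $G$ of bounded exponent is isomorphic to a direct sum $\bigoplus_{p\in M}\bigoplus_{i=1}^{n_p}\mathbb{Z}(p^i)^{(k_{i,p})}$, where $M$ is a finite set of primes, $\mathbb{Z}(p^i)$ is the cyclic group of order $p^i$, the $k_{i,p}$ are cardinal numbers, and, for each $p\in M$, $n_p\ge 1$ and $k_{n_p,p}\neq 0$; the cardinals $k_{n_p,p}$, $p\in M$, do not depend on the decomposition and are called the leading Ulm–Kaplansky invariants of $G$. **Theorem 3.** Let $G$ be an infinite Abelian group of bounded exponent (and of arbitrary cardinality). Then $G$ admits a minimally almost periodic Hausdorff group topology if and only if all leading Ulm–Kaplansky invariants of $G$ are infinite. -/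

import Mathlib

universe u

open scoped DirectSum

/-- The von Neumann radical `n(X)` of an Abelian topological group: the intersection of the kernels
of all continuous characters `χ : X → 𝕋`. -/
def vonNeumannRadical (X : Type u) [AddCommGroup X] [TopologicalSpace X] : AddSubgroup X where
  carrier := {x | ∀ χ : AddChar X Circle, Continuous χ → χ x = 1}
  zero_mem' := fun χ _ => χ.map_zero_eq_one
  add_mem' := fun {a b} ha hb χ hχ => by rw [χ.map_add_eq_mul, ha χ hχ, hb χ hχ, mul_one]
  neg_mem' := fun {a} ha χ hχ => by rw [AddChar.map_neg_eq_inv, ha χ hχ, inv_one]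

/-- An Abelian topological group is minimally almost periodic if it coincides with its
von Neumann radical. -/
def IsMinAP (X : Type u) [AddCommGroup X] [TopologicalSpace X] : Prop :=
  vonNeumannRadical X = ⊤

/-- `G` admits a minimally almost periodic Hausdorff group topology. -/
def AdmitsMinAPTopology (G : Type u) [AddCommGroup G] : Prop :=
  ∃ τ : TopologicalSpace G,
    @IsTopologicalAddGroup G τ _ ∧ @T2Space G τ ∧ @IsMinAP G _ τ

/-- A decomposition `G ≅ ⨁_{p ∈ M} ⨁_{i = 1}^{n_p} ℤ(p^i)^{(k_{i,p})}` of an Abelian group, where `M`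
is a finite set of primes and, for each `p ∈ M`, the index `n_p ≥ 1` is the largest one that really
occurs (that is, `k_{n_p,p} ≠ 0`). The cardinal `k_{i,p}` is given as the cardinality of an index
type `I p i`, which may be empty for `i < n_p`. -/
structure CyclicDecomposition (G : Type u) [AddCommGroup G] where
  M : Finset ℕ
  prime : ∀ p ∈ M, p.Prime
  n : ℕ → ℕ
  one_le_n : ∀ p ∈ M, 1 ≤ n p
  I : ℕ → ℕ → Type u
  nonempty_top : ∀ p ∈ M, Nonempty (I p (n p))
  equiv : G ≃+ ⨁ p : M, ⨁ i : Finset.Icc 1 (n p), (I p i →₀ ZMod ((p : ℕ) ^ (i : ℕ)))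

/-- The multiplicity `k_{i,p}` of `ℤ(p^i)` in the decomposition. -/
def CyclicDecomposition.k {G : Type u} [AddCommGroup G] (D : CyclicDecomposition G) (p i : ℕ) :
    Cardinal.{u} :=
  Cardinal.mk (D.I p i)

/-- The leading Ulm–Kaplansky invariants of a bounded Abelian group `G`: the cardinals `k_{n_p,p}`,
`p ∈ M`, read off from a decomposition of `G` into cyclic groups of prime power order. -/
def leadingUlmKaplanskyInvariants (G : Type u) [AddCommGroup G] : Set Cardinal.{u} :=
  {κ | ∃ D : CyclicDecomposition G, ∃ p ∈ D.M, κ = D.k p (D.n p)}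

/-! Necessity: if a leading invariant at `p` is finite, some multiple `m • G` is finite and nonzero.
It is then discrete in any Hausdorff group topology, so a nontrivial character of it composed with
`x ↦ m • x` is a nontrivial continuous character of `G` (`nsmul_eq_zero_of_finite`). Sufficiency:
for infinite `X` and `A` of bounded exponent, read `Finset X →₀ A` as multilinear polynomials on the
cube `X → Bool`, normed by the measure of the set where they do not vanish. A continuous character
is trivial on a small ball, because its values are roots of unity of bounded order. Every polynomial
is a finite sum of polynomials vanishing off cylinders of small measure, so the character is trivial
everywhere (`admitsMinAPTopology_finset_finsupp`). Prüfer's theorem reduces `G` to finitely many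
homogeneous blocks; infinite blocks are covered by this construction, and the finite ones are
absorbed by the infinite leading block through a quotient with finite kernel. -/

theorem isMinAP_iff {X : Type u} [AddCommGroup X] [TopologicalSpace X] :
    IsMinAP X ↔ ∀ χ : AddChar X Circle, Continuous χ → ∀ x, χ x = 1 := by
  rw [IsMinAP, AddSubgroup.eq_top_iff']
  exact ⟨fun h χ hχ x => h x χ hχ, fun h x χ hχ => h χ hχ x⟩

/-! ### Permanence properties. -/

theorem AdmitsMinAPTopology.of_addEquiv {G H : Type*} [AddCommGroup G] [AddCommGroup H]
    (h : AdmitsMinAPTopology G) (e : G ≃+ H) : AdmitsMinAPTopology H := by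
  obtain ⟨τ, h1, h2, h3⟩ := h
  let τ' : TopologicalSpace H := .induced e.symm τ
  have hind : Topology.IsInducing e.symm := ⟨rfl⟩
  have he : Continuous e := by
    rw [hind.continuous_iff]
    convert! continuous_id
    ext x
    simp
  refine ⟨τ', topologicalAddGroup_induced e.symm,
    T2Space.of_injective_continuous e.symm.injective hind.continuous, ?_⟩
  rw [isMinAP_iff] at h3 ⊢
  intro χ hχ x
  simpa using h3 (χ.compAddMonoidHom e.toAddMonoidHom) (hχ.comp he) (e.symm x)

theorem AdmitsMinAPTopology.pi {ι : Type*} [Finite ι] {G : ι → Type*} [∀ i, AddCommGroup (G i)]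
    (h : ∀ i, AdmitsMinAPTopology (G i)) : AdmitsMinAPTopology (∀ i, G i) := by
  classical
  have := Fintype.ofFinite ι
  choose τ h1 h2 h3 using h
  refine ⟨inferInstance, inferInstance, inferInstance, ?_⟩
  rw [isMinAP_iff]
  intro χ hχ x
  have h4 i (y : G i) : χ (Pi.single i y) = 1 :=
    isMinAP_iff.1 (h3 i) (χ.compAddMonoidHom (AddMonoidHom.single G i))
      (hχ.comp (continuous_single i)) y
  rw [← Finset.univ_sum_single x]
  refine Finset.sum_induction _ (fun y => χ y = 1) (fun a b ha hb => ?_) χ.map_zero_eq_one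
    fun i _ => h4 i _
  rw [AddChar.map_add_eq_mul, ha, hb, mul_one]

theorem AdmitsMinAPTopology.prod {G H : Type*} [AddCommGroup G] [AddCommGroup H]
    (hG : AdmitsMinAPTopology G) (hH : AdmitsMinAPTopology H) : AdmitsMinAPTopology (G × H) := by
  obtain ⟨_, _, _, hG⟩ := hG
  obtain ⟨_, _, _, hH⟩ := hH
  refine ⟨inferInstance, inferInstance, inferInstance, ?_⟩
  rw [isMinAP_iff] at *
  intro χ hχ x
  have h1 := hG (χ.compAddMonoidHom (AddMonoidHom.inl G H))
    (hχ.comp (continuous_id.prodMk continuous_const)) x.1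
  have h2 := hH (χ.compAddMonoidHom (AddMonoidHom.inr G H))
    (hχ.comp (continuous_const.prodMk continuous_id)) x.2
  have hx : x = (x.1, 0) + (0, x.2) := by simp
  rw [hx, AddChar.map_add_eq_mul]
  simpa using congr($h1 * $h2)

/-- A finite kernel is closed in a Hausdorff topology, so the quotient topology is again Hausdorff;
its characters pull back to `G`. -/
theorem AdmitsMinAPTopology.of_surjective {G H : Type*} [AddCommGroup G] [AddCommGroup H]
    (hG : AdmitsMinAPTopology G) (f : G →+ H) (hf : Function.Surjective f)
    (hker : (f.ker : Set G).Finite) : AdmitsMinAPTopology H := by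
  refine AdmitsMinAPTopology.of_addEquiv ?_ (QuotientAddGroup.quotientKerEquivOfSurjective f hf)
  obtain ⟨_, _, _, hG⟩ := hG
  have : IsClosed (f.ker : Set G) := hker.isClosed
  refine ⟨inferInstance, inferInstance, inferInstance, ?_⟩
  rw [isMinAP_iff] at *
  intro χ hχ x
  obtain ⟨y, rfl⟩ := QuotientAddGroup.mk_surjective x
  exact hG (χ.compAddMonoidHom (QuotientAddGroup.mk' f.ker)) (hχ.comp continuous_quot_mk) y

open MeasureTheory

/-! ### Characters of groups of bounded exponent. -/

theorem finite_setOf_circle_pow_eq_one {m : ℕ} (hm : 0 < m) : {z : Circle | z ^ m = 1}.Finite := by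
  have h : {z : ℂ | z ^ m = 1}.Finite :=
    (Polynomial.nthRootsFinset m (1 : ℂ)).finite_toSet.subset fun z hz => by
      simpa [Polynomial.mem_nthRootsFinset hm] using hz
  refine (h.preimage Circle.coe_injective.injOn).subset fun (z : Circle) hz => ?_
  have hz : z ^ m = 1 := hz
  change (z : ℂ) ^ m = 1
  rw [← Circle.coe_pow, hz, Circle.coe_one]

theorem AddChar.eventually_eq_one_of_exponent {G : Type*} [AddCommGroup G] [TopologicalSpace G]
    {m : ℕ} (hm : 0 < m) (hG : ∀ x : G, m • x = 0) (χ : AddChar G Circle) (hχ : Continuous χ) :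
    ∀ᶠ x in nhds (0 : G), χ x = 1 := by
  have h1 : {z : Circle | z ^ m = 1 ∧ z ≠ 1}ᶜ ∈ nhds (χ 0) := by
    have hfin : {z : Circle | z ^ m = 1 ∧ z ≠ 1}.Finite :=
      (finite_setOf_circle_pow_eq_one hm).subset fun z hz => hz.1
    exact hfin.isClosed.isOpen_compl.mem_nhds (by simp)
  filter_upwards [hχ.continuousAt h1] with x hx
  by_contra h
  refine hx ⟨?_, h⟩
  rw [← AddChar.map_nsmul_eq_pow, hG, AddChar.map_zero_eq_one]

/-! ### Multilinear polynomials on the Cantor cube. -/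

section Walsh

variable {X A : Type*} [AddCommGroup A]

/-- The value at a 0-1 sequence `x` of the multilinear polynomial with coefficients `a`. -/
noncomputable def multilinearEval (x : X → Bool) : (Finset X →₀ A) →+ A :=
  Finsupp.liftAddHom fun F => open Classical in
    if ∀ i ∈ F, x i = true then AddMonoidHom.id A else 0

theorem multilinearEval_apply (x : X → Bool) (a : Finset X →₀ A) :
    multilinearEval x a = a.sum fun F v => open Classical in
      if ∀ i ∈ F, x i = true then v else 0 := by
  classical
  simp only [multilinearEval, Finsupp.liftAddHom_apply]
  refine Finsupp.sum_congr fun F _ => ?_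
  split_ifs <;> rfl

/-- Inserting `i` into every exponent set is multiplication by the variable `x i`, since `x i` is
idempotent. -/
theorem multilinearEval_mapDomain_insert [DecidableEq X] (x : X → Bool) (i : X)
    (a : Finset X →₀ A) :
    multilinearEval x (a.mapDomain (insert i)) = if x i then multilinearEval x a else 0 := by
  classical
  induction a using Finsupp.induction_linear with
  | zero => simp
  | add f g hf hg =>
    rw [Finsupp.mapDomain_add, map_add, hf, hg, map_add]
    split_ifs <;> simp
  | single F v =>
    rw [Finsupp.mapDomain_single]
    by_cases h : x i <;> simp [multilinearEval_apply, h]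

/-- The product of the fair coin measures. -/
noncomputable def coinMeasure (X : Type*) : Measure (X → Bool) :=
  Measure.infinitePi fun _ => (PMF.uniformOfFintype Bool).toMeasure

instance : IsProbabilityMeasure (coinMeasure X) := by
  unfold coinMeasure; infer_instance

theorem coinMeasure_cylinder (K : Finset X) (η : X → Bool) :
    coinMeasure X {x | ∀ i ∈ K, x i = η i} = 2⁻¹ ^ K.card := by
  have h := Measure.infinitePi_pi (fun _ : X => (PMF.uniformOfFintype Bool).toMeasure)
    (s := K) (t := fun i => {η i}) (fun i _ => measurableSet_singleton _)
  convert! h using 1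
  simp

/-- Take `F` minimal in the support and pin all occurring variables to the indicator of `F`: only
the monomial `F` survives. This makes the norm definite, hence the topology Hausdorff. -/
theorem exists_cylinder_multilinearEval_ne_zero {a : Finset X →₀ A} (ha : a ≠ 0) :
    ∃ (K : Finset X) (η : X → Bool), ∀ x, (∀ i ∈ K, x i = η i) → multilinearEval x a ≠ 0 := by
  classical
  obtain ⟨F, hF⟩ := a.support.exists_minimal (Finsupp.support_nonempty_iff.2 ha)
  refine ⟨a.support.sup id, fun i => decide (i ∈ F), fun x hx => ?_⟩
  rw [multilinearEval_apply, Finsupp.sum, Finset.sum_eq_single F]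
  · have hFF : ∀ i ∈ F, x i = true := fun i hi => by
      rw [hx i (Finset.mem_sup.2 ⟨F, hF.1, hi⟩)]
      simpa using hi
    rw [if_pos hFF]
    exact Finsupp.mem_support_iff.1 hF.1
  · intro F' hF' hne
    rw [if_neg]
    intro h
    have hsub : F' ≤ F := fun i hi => by
      have := h i hi
      rw [hx i (Finset.mem_sup.2 ⟨F', hF', hi⟩)] at this
      simpa using this
    exact hne (le_antisymm hsub (hF.2 hF' hsub))
  · intro h
    exact absurd hF.1 h

variable (X A) in
/-- The measure of the support of a multilinear polynomial, as a group norm. -/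
noncomputable def multilinearNorm : AddGroupNorm (Finset X →₀ A) where
  toFun a := (coinMeasure X).real {x | multilinearEval x a ≠ 0}
  map_zero' := by simp
  add_le' a b := by
    refine (measureReal_mono ?_).trans (measureReal_union_le _ _)
    intro x hx
    by_contra h
    simp only [Set.mem_union, Set.mem_ofPred_eq, not_or, not_not] at h
    exact hx (by rw [map_add, h.1, h.2, add_zero])
  neg' a := by simp
  eq_zero_of_map_eq_zero' a h := by
    by_contra ha
    obtain ⟨K, η, hK⟩ := exists_cylinder_multilinearEval_ne_zero ha
    have h1 : coinMeasure X {x | ∀ i ∈ K, x i = η i} = 0 :=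
      measure_mono_null hK ((measureReal_eq_zero_iff).1 h)
    rw [coinMeasure_cylinder] at h1
    simp at h1

theorem multilinearNorm_le_of_cylinder {a : Finset X →₀ A} {K : Finset X} {η : X → Bool}
    (h : ∀ x, multilinearEval x a ≠ 0 → ∀ i ∈ K, x i = η i) :
    multilinearNorm X A a ≤ (1 / 2) ^ K.card := by
  have : (coinMeasure X).real {x | ∀ i ∈ K, x i = η i} = (1 / 2) ^ K.card := by
    simp [Measure.real, coinMeasure_cylinder]
  rw [← this]
  exact measureReal_mono h

theorem admitsMinAPTopology_finset_finsupp [Infinite X] {m : ℕ} (hm : 0 < m)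
    (hA : ∀ x : A, m • x = 0) : AdmitsMinAPTopology (Finset X →₀ A) := by
  classical
  let _ : NormedAddCommGroup (Finset X →₀ A) := (multilinearNorm X A).toNormedAddCommGroup
  refine ⟨inferInstance, inferInstance, inferInstance, ?_⟩
  rw [isMinAP_iff]
  intro χ hχ x
  have h1 := AddChar.eventually_eq_one_of_exponent hm
    (fun a : Finset X →₀ A => Finsupp.ext fun F => hA _) χ hχ
  obtain ⟨ε, hε, hball⟩ := Metric.eventually_nhds_iff.1 h1
  obtain ⟨N, hN⟩ := exists_pow_lt_of_lt_one hε (by norm_num : (1 / 2 : ℝ) < 1)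
  obtain ⟨K, hK⟩ := Infinite.exists_subset_card_eq X N
  -- Coordinates are removed from `K` one at a time: `a = x_i a + (1 - x_i) a`, and both terms
  -- vanish off cylinders that also fix coordinate `i`.
  have key : ∀ K : Finset X, (∀ (η : X → Bool) (a : Finset X →₀ A),
      (∀ x, multilinearEval x a ≠ 0 → ∀ i ∈ K, x i = η i) → χ a = 1) → ∀ a, χ a = 1 := by
    intro K
    induction K using Finset.induction_on with
    | empty => exact fun h a => h (fun _ => true) a (by simp)
    | insert i K hi ih =>
      refine fun h => ih fun η a ha => ?_
      have hK : ∀ (x : X → Bool) b, ∀ j ∈ K, x j = η j → x j = Function.update η i b j := by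
        intro x b j hj hx
        rw [Function.update_of_ne (ne_of_mem_of_not_mem hj hi), hx]
      have ha1 : χ (a.mapDomain (insert i)) = 1 := by
        refine h (Function.update η i true) _ fun x hx => ?_
        rw [multilinearEval_mapDomain_insert] at hx
        simp only [ne_eq, ite_eq_right_iff, Classical.not_imp] at hx
        rw [Finset.forall_mem_insert]
        exact ⟨by simp [hx.1], fun j hj => hK x _ j hj (ha x hx.2 j hj)⟩
      have ha2 : χ (a - a.mapDomain (insert i)) = 1 := by
        refine h (Function.update η i false) _ fun x hx => ?_
        rw [map_sub, multilinearEval_mapDomain_insert] at hx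
        have hxi : x i = false := by
          by_contra hxi
          simp [Bool.eq_true_of_not_eq_false hxi] at hx
        simp only [hxi, Bool.false_eq_true, if_false, sub_zero] at hx
        rw [Finset.forall_mem_insert]
        exact ⟨by simp [hxi], fun j hj => hK x _ j hj (ha x hx j hj)⟩
      rw [← sub_add_cancel a (a.mapDomain (insert i)), AddChar.map_add_eq_mul, ha1, ha2, one_mul]
  refine key K (fun η a ha => hball ?_) x
  rw [dist_zero_right]
  refine (multilinearNorm_le_of_cylinder ha).trans_lt ?_
  rwa [hK]

theorem admitsMinAPTopology_finsupp [Infinite X] {m : ℕ} (hm : 0 < m)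
    (hA : ∀ x : A, m • x = 0) : AdmitsMinAPTopology (X →₀ A) := by
  obtain ⟨e⟩ := Cardinal.eq.1 (Cardinal.mk_finset_of_infinite X)
  exact (admitsMinAPTopology_finset_finsupp hm hA).of_addEquiv (Finsupp.domCongr e)

end Walsh

/-! ### Absorbing a finite summand. -/

theorem admitsMinAPTopology_finite_prod_finsupp {F X : Type*} {m : ℕ} [NeZero m] [Finite F]
    [AddCommGroup F] [Module (ZMod m) F] [Infinite X] :
    AdmitsMinAPTopology (F × (X →₀ ZMod m)) := by
  have h1 : AdmitsMinAPTopology (F ⊕ X →₀ ZMod m) :=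
    admitsMinAPTopology_finsupp (NeZero.pos m) fun x => by simp
  have h2 := h1.of_addEquiv Finsupp.sumFinsuppAddEquivProdFinsupp
  -- `F` is a quotient of the free module on its own finite underlying set, so the kernel is finite.
  let l : (F →₀ ZMod m) →ₗ[ZMod m] F := Finsupp.linearCombination (ZMod m) id
  refine h2.of_surjective (l.toAddMonoidHom.prodMap (AddMonoidHom.id _)) ?_ ?_
  · exact Function.Surjective.prodMap (Finsupp.linearCombination_id_surjective _ _)
      Function.surjective_id
  · have : Finite (F →₀ ZMod m) := .of_injective _ DFunLike.coe_injective
    refine ((Set.finite_univ (α := F →₀ ZMod m)).prod (Set.finite_singleton 0)).subset ?_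
    rintro ⟨x, y⟩ hxy
    exact ⟨Set.mem_univ _, congr(($hxy).2)⟩

/-! ### Prüfer's theorem. -/

theorem ZMod.nsmul_natCast_val_div {m : ℕ} [NeZero m] {d : ℕ} {x : ZMod m} (h : d ∣ x.val) :
    d • ((x.val / d : ℕ) : ZMod m) = x := by
  rw [nsmul_eq_mul, ← Nat.cast_mul, Nat.mul_div_cancel' h, ZMod.natCast_zmod_val]

theorem Finsupp.exists_nsmul_eq_of_dvd_val {J : Type*} {m : ℕ} [NeZero m] {d : ℕ}
    {c : J →₀ ZMod m} (h : ∀ j, d ∣ (c j).val) : ∃ c' : J →₀ ZMod m, d • c' = c :=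
  ⟨c.mapRange (fun x => ((x.val / d : ℕ) : ZMod m)) (by simp), Finsupp.ext fun j => by
    rw [Finsupp.smul_apply, Finsupp.mapRange_apply, ZMod.nsmul_natCast_val_div (h j)]⟩

theorem ZMod.exists_dvd_ideal_eq_span {m : ℕ} [NeZero m] (I : Ideal (ZMod m)) :
    ∃ d : ℕ, d ∣ m ∧ I = Ideal.span {(d : ZMod m)} := by
  have : IsPrincipalIdealRing (ZMod m) :=
    IsPrincipalIdealRing.of_surjective (Int.castRingHom (ZMod m)) ZMod.intCast_surjective
  obtain ⟨x, hx⟩ := (IsPrincipalIdealRing.principal I).principal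
  refine ⟨x.val.gcd m, Nat.gcd_dvd_right _ _, ?_⟩
  rw [hx]
  apply le_antisymm
  · rw [Submodule.span_singleton_le_iff_mem]
    obtain ⟨k, hk⟩ := Nat.gcd_dvd_left x.val m
    refine Ideal.mem_span_singleton.2 ⟨k, ?_⟩
    rw [← Nat.cast_mul, ← hk, ZMod.natCast_zmod_val]
  · rw [Ideal.span_singleton_le_iff_mem]
    have h := congr((($(Nat.gcd_eq_gcd_ab x.val m) : ℤ) : ZMod m))
    push_cast at h
    rw [ZMod.natCast_self, zero_mul, add_zero, ZMod.natCast_zmod_val] at h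
    rw [h]
    exact Ideal.mul_mem_right _ _ (Submodule.mem_span_singleton_self x)

/-- An ideal is generated by some `d ∣ m`; the image of `d` is killed by `m / d`, hence divisible by
`d`, and a quotient by `d` defines the extension. This injectivity is what splits off the top block.
-/
theorem ZMod.baer_finsupp (m : ℕ) [NeZero m] (J : Type*) :
    Module.Baer (ZMod m) (J →₀ ZMod m) := by
  intro I g
  obtain ⟨d, ⟨k, hk⟩, rfl⟩ := ZMod.exists_dvd_ideal_eq_span I
  have hk0 : 0 < k := Nat.pos_of_ne_zero fun h => NeZero.ne m (by rw [hk, h, mul_zero])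
  have hd : (d : ZMod m) ∈ Ideal.span {(d : ZMod m)} := Ideal.mem_span_singleton_self _
  have hdvd : ∀ j, d ∣ (g ⟨d, hd⟩ j).val := by
    intro j
    have h1 : k • (⟨d, hd⟩ : Ideal.span {(d : ZMod m)}) = 0 := by
      ext
      simp [← Nat.cast_mul, mul_comm k, ← hk]
    have h2 : k • g ⟨d, hd⟩ j = 0 := by
      rw [← Finsupp.smul_apply, ← map_nsmul, h1, map_zero, Finsupp.zero_apply]
    rw [← ZMod.natCast_zmod_val (g ⟨d, hd⟩ j), nsmul_eq_mul, ← Nat.cast_mul,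
      ZMod.natCast_eq_zero_iff] at h2
    exact Nat.dvd_of_mul_dvd_mul_left hk0 ((dvd_of_eq (by rw [hk, mul_comm])).trans h2)
  obtain ⟨c, hc⟩ := Finsupp.exists_nsmul_eq_of_dvd_val hdvd
  refine ⟨LinearMap.toSpanSingleton _ _ c, fun x hx => ?_⟩
  obtain ⟨y, rfl⟩ := Ideal.mem_span_singleton.1 hx
  have : (⟨d * y, hx⟩ : Ideal.span {(d : ZMod m)}) = y • ⟨d, hd⟩ := by
    ext
    simp [mul_comm]
  rw [this, map_smul, ← hc, LinearMap.toSpanSingleton_apply, mul_comm, mul_smul,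
    Nat.cast_smul_eq_nsmul]

/-- If the exponent of `G` divides `p ^ (N + 1)`, a basis of `p ^ N • G` lifts to a basis of a direct
summand of `G`. -/
theorem exists_addEquiv_finsupp_prod_of_basis {p : ℕ} [Fact p.Prime] {N : ℕ} {G J : Type*}
    [AddCommGroup G] [Module (ZMod (p ^ (N + 1))) G]
    [Module (ZMod p) (nsmulAddMonoidHom (α := G) (p ^ N)).range]
    (b : Module.Basis J (ZMod p) (nsmulAddMonoidHom (α := G) (p ^ N)).range) :
    ∃ K : AddSubgroup G, Nonempty (G ≃+ (J →₀ ZMod (p ^ (N + 1))) × K) ∧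
      ∀ x ∈ K, p ^ N • x = 0 := by
  classical
  have hdvd : p ∣ p ^ (N + 1) := dvd_pow_self p (by omega)
  have hg : ∀ j : J, ∃ x : G, p ^ N • x = b j := fun j => (b j).2
  choose g hg using hg
  let φ : (J →₀ ZMod (p ^ (N + 1))) →ₗ[ZMod (p ^ (N + 1))] G :=
    Finsupp.linearCombination (ZMod (p ^ (N + 1))) g
  let r : (J →₀ ZMod (p ^ (N + 1))) →+ (J →₀ ZMod p) :=
    Finsupp.mapRange.addMonoidHom (ZMod.castHom hdvd (ZMod p)).toAddMonoidHom
  -- After multiplication by `p ^ N`, only `c` modulo `p` matters, and the basis sees it faithfully.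
  have hφr : ∀ c, p ^ N • φ c = b.repr.symm (r c) := by
    intro c
    induction c using Finsupp.induction_linear with
    | zero => simp
    | add c d hc hd => rw [map_add, smul_add, hc, hd, map_add, map_add, AddSubgroup.coe_add]
    | single j x =>
      obtain ⟨n, rfl⟩ := ZMod.natCast_zmod_surjective x
      simp only [φ, r, Finsupp.linearCombination_single, Finsupp.mapRange.addMonoidHom_apply,
        Finsupp.mapRange_single, Module.Basis.repr_symm_single]
      rw [Nat.cast_smul_eq_nsmul]
      have : (ZMod.castHom hdvd (ZMod p)).toAddMonoidHom (n : ZMod (p ^ (N + 1))) = (n : ZMod p) :=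
        map_natCast (ZMod.castHom hdvd (ZMod p)) n
      rw [this, Nat.cast_smul_eq_nsmul, smul_comm, hg, AddSubgroup.coe_nsmul]
  have hr0 : ∀ c, r c = 0 → ∃ c', p • c' = c := by
    intro c hc
    refine Finsupp.exists_nsmul_eq_of_dvd_val fun j => ?_
    have h : ZMod.castHom hdvd (ZMod p) (c j) = 0 := DFunLike.congr_fun hc j
    rwa [← ZMod.natCast_zmod_val (c j), map_natCast, ZMod.natCast_eq_zero_iff] at h
  have hrs : Function.Surjective r := by
    intro c
    choose s hs using ZMod.castHom_surjective hdvd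
    refine ⟨c.mapRange (fun x => if x = 0 then 0 else s x) (by simp), ?_⟩
    ext j
    simp only [r, Finsupp.mapRange.addMonoidHom_apply, Finsupp.mapRange_apply]
    split_ifs with h
    · simp [h]
    · exact hs _
  have hφ : Function.Injective φ := by
    rw [injective_iff_map_eq_zero]
    intro c hc
    -- An element of the kernel is divisible by ever higher powers of `p`, up to `p ^ (N + 1)`,
    -- which is zero in the coefficients.
    have key : ∀ k ≤ N + 1, ∃ c', p ^ k • c' = c := by
      intro k
      induction k with
      | zero => exact fun _ => ⟨c, by simp⟩
      | succ k ih =>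
        intro hk
        obtain ⟨c', hc'⟩ := ih (by omega)
        have h1 : p ^ N • φ c' = 0 := by
          have : p ^ N = p ^ (N - k) * p ^ k := by rw [← pow_add]; congr 1; omega
          rw [this, mul_smul, ← map_nsmul φ, hc', hc, smul_zero]
        rw [hφr, ZeroMemClass.coe_eq_zero, LinearEquiv.map_eq_zero_iff] at h1
        obtain ⟨c'', rfl⟩ := hr0 c' h1
        exact ⟨c'', by rw [← hc', smul_smul, ← pow_succ]⟩
    obtain ⟨c', rfl⟩ := key (N + 1) le_rfl
    ext j
    rw [Finsupp.smul_apply, nsmul_eq_mul, ZMod.natCast_self, zero_mul, Finsupp.zero_apply]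
  obtain ⟨ρ, hρ⟩ := (ZMod.baer_finsupp (p ^ (N + 1)) J).extension_property φ hφ LinearMap.id
  have hρ' : ∀ c, ρ (φ c) = c := fun c => LinearMap.congr_fun hρ c
  refine ⟨ρ.toAddMonoidHom.ker, ⟨(AddEquiv.ofBijective
    (φ.toAddMonoidHom.coprod ρ.toAddMonoidHom.ker.subtype) ⟨?_, ?_⟩).symm⟩, ?_⟩
  · rw [injective_iff_map_eq_zero]
    rintro ⟨c, k, hk⟩ h
    replace h : φ c + k = 0 := h
    replace hk : ρ k = 0 := hk
    have hc : c = 0 := by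
      have := congr(ρ $h)
      rwa [map_add, hρ', hk, add_zero, map_zero] at this
    subst hc
    rw [map_zero, zero_add] at h
    subst h
    rfl
  · intro x
    refine ⟨⟨ρ x, x - φ (ρ x), ?_⟩, ?_⟩
    · change ρ (x - φ (ρ x)) = 0
      rw [map_sub, hρ', sub_self]
    · change φ (ρ x) + (x - φ (ρ x)) = x
      abel
  · intro x hx
    replace hx : ρ x = 0 := hx
    -- Here `p ^ N • x = p ^ N • φ c`; applying the retraction `ρ`, which kills `x`, gives `p ^ N •
    -- c = 0`.
    obtain ⟨c, hc⟩ := hrs (b.repr ⟨p ^ N • x, x, rfl⟩)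
    have h1 := hφr c
    rw [hc, LinearEquiv.symm_apply_apply] at h1
    change _ = p ^ N • x at h1
    have h2 := congr(ρ $h1)
    rw [map_nsmul, map_nsmul, hρ', hx, smul_zero] at h2
    rw [← h1, ← map_nsmul, h2, map_zero]

/-- A group of exponent dividing `p ^ (N + 1)` splits into a direct sum of cyclic groups of order
`p ^ (N + 1)` and a group of exponent dividing `p ^ N`. -/
theorem exists_addEquiv_finsupp_prod_of_pow_nsmul {p : ℕ} [Fact p.Prime] {N : ℕ} {G : Type u}
    [AddCommGroup G] (hG : ∀ x : G, p ^ (N + 1) • x = 0) :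
    ∃ (J : Type u) (K : AddSubgroup G), Nonempty (G ≃+ (J →₀ ZMod (p ^ (N + 1))) × K) ∧
      ∀ x ∈ K, p ^ N • x = 0 := by
  let _ : Module (ZMod (p ^ (N + 1))) G := AddCommGroup.zmodModule hG
  have hW : ∀ x : (nsmulAddMonoidHom (α := G) (p ^ N)).range, p • x = 0 := by
    rintro ⟨_, y, rfl⟩
    ext
    simp [← mul_nsmul, ← pow_succ, hG]
  let _ : Module (ZMod p) (nsmulAddMonoidHom (α := G) (p ^ N)).range := AddCommGroup.zmodModule hW
  exact ⟨_, exists_addEquiv_finsupp_prod_of_basis (Module.Basis.ofVectorSpace (ZMod p) _)⟩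

/-- Split off the factor with index `0` from a finite product of powers of cyclic groups. -/
noncomputable def finsuppPiFinSuccEquiv (p N : ℕ) (I : ℕ → Type u) :
    (I 0 →₀ ZMod (p ^ (N + 1))) × (∀ i : Fin N, (I (i + 1) →₀ ZMod (p ^ (N - i)))) ≃+
      ∀ i : Fin (N + 1), (I i →₀ ZMod (p ^ (N + 1 - i))) :=
  ((AddEquiv.refl (I 0 →₀ ZMod (p ^ (N + 1)))).prodCongr (AddEquiv.piCongrRight fun i : Fin N =>
    Finsupp.mapRange.addEquiv (ι := I (i + 1)) (ZMod.ringEquivCongr (by simp) :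
      ZMod (p ^ (N - i)) ≃+* ZMod (p ^ (N + 1 - (i + 1)))).toAddEquiv)).trans
  (Fin.consLinearEquiv ℤ fun i : Fin (N + 1) => (I i →₀ ZMod (p ^ (N + 1 - i)))).toAddEquiv

/-- Exponents are listed in decreasing order, so that each inductive step puts the new top block at
index `0`. -/
theorem exists_addEquiv_pi_fin_finsupp {p : ℕ} [Fact p.Prime] (N : ℕ) (G : Type u)
    [AddCommGroup G] (hG : ∀ x : G, p ^ N • x = 0) :
    ∃ I : ℕ → Type u, Nonempty (G ≃+ ∀ i : Fin N, (I i →₀ ZMod (p ^ (N - i)))) := by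
  induction N generalizing G with
  | zero =>
    have : Subsingleton G := ⟨fun x y => by
      rw [← one_nsmul x, ← one_nsmul y, ← pow_zero p, hG, hG]⟩
    have : Unique G := uniqueOfSubsingleton 0
    exact ⟨fun _ => PUnit, ⟨AddEquiv.ofUnique⟩⟩
  | succ N ih =>
    obtain ⟨J, K, ⟨e⟩, hK⟩ := exists_addEquiv_finsupp_prod_of_pow_nsmul hG
    obtain ⟨I, ⟨f⟩⟩ := ih K fun x => by
      ext
      exact hK x x.2
    exact ⟨fun i => Nat.casesOn i J I, ⟨(e.trans ((AddEquiv.refl _).prodCongr f)).trans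
      (finsuppPiFinSuccEquiv p N fun i => Nat.casesOn i J I)⟩⟩

theorem exists_addEquiv_directSum_finsupp {p : ℕ} [Fact p.Prime] (N : ℕ) (G : Type u)
    [AddCommGroup G] (hG : ∀ x : G, p ^ N • x = 0) :
    ∃ I : ℕ → Type u,
      Nonempty (G ≃+ ⨁ i : Finset.Icc 1 N, (I i →₀ ZMod (p ^ (i : ℕ)))) := by
  obtain ⟨I, ⟨e⟩⟩ := exists_addEquiv_pi_fin_finsupp N G hG
  let σ : Finset.Icc 1 N ≃ Fin N :=
    { toFun i := ⟨N - i, by have := Finset.mem_Icc.1 i.2; omega⟩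
      invFun i := ⟨N - i, by have := i.2; simp; omega⟩
      left_inv i := by ext; have := Finset.mem_Icc.1 i.2; simp; omega
      right_inv i := by ext; have := i.2; simp; omega }
  refine ⟨fun i => I (N - i), ⟨(e.trans ?_).trans (DirectSum.addEquivProd _).symm⟩⟩
  refine (LinearEquiv.piCongrLeft ℤ
    (fun i : Fin N => (I i →₀ ZMod (p ^ (N - i)))) σ).symm.toAddEquiv.trans ?_
  exact AddEquiv.piCongrRight fun i => Finsupp.mapRange.addEquiv (ZMod.ringEquivCongr (by
    have := Finset.mem_Icc.1 i.2
    congr 1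
    simp [σ]
    omega)).toAddEquiv

theorem pow_pred_nsmul_eq_zero_of_isEmpty {p N : ℕ} {I : ℕ → Type*} (hI : IsEmpty (I N))
    (x : ⨁ i : Finset.Icc 1 N, (I i →₀ ZMod (p ^ (i : ℕ)))) : p ^ (N - 1) • x = 0 := by
  ext i j
  obtain ⟨i, hi⟩ := i
  rcases (Finset.mem_Icc.1 hi).2.eq_or_lt with rfl | hlt
  · exact hI.elim j
  · have h : p ^ i ∣ p ^ (N - 1) := pow_dvd_pow _ (by omega)
    change p ^ (N - 1) • (x ⟨i, hi⟩ j : ZMod (p ^ i)) = 0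
    rw [nsmul_eq_mul, (ZMod.natCast_eq_zero_iff _ _).2 h, zero_mul]

/-- Prüfer's first theorem: a group of bounded exponent is a direct sum of cyclic groups. -/
theorem nonempty_cyclicDecomposition {G : Type u} [AddCommGroup G]
    (hG : AddMonoid.ExponentExists G) : Nonempty (CyclicDecomposition G) := by
  classical
  let E := AddMonoid.exponent G
  have hE : E ≠ 0 := AddMonoid.exponent_ne_zero.2 hG
  let q : ℕ → ℤ := fun p => ((p ^ E.factorization p : ℕ) : ℤ)
  have hint : DirectSum.IsInternal fun p : E.primeFactors => Submodule.torsionBy ℤ G (q p) := by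
    refine Submodule.torsionBy_isInternal (fun p hp r hr hne => ?_) fun x => ?_
    · exact Nat.Coprime.isCoprime (Nat.Coprime.pow _ _
        ((Nat.coprime_primes (Nat.prime_of_mem_primeFactors hp)
          (Nat.prime_of_mem_primeFactors hr)).2 hne))
    · have hprod : ∏ p ∈ E.primeFactors, p ^ E.factorization p = E :=
        Nat.prod_factorization_pow_eq_self hE
      rw [← Nat.cast_prod, hprod, Nat.cast_smul_eq_nsmul]
      exact AddMonoid.exponent_nsmul_eq_zero x
  have htors : ∀ (p : ℕ) (x : Submodule.torsionBy ℤ G (q p)),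
      p ^ E.factorization p • x = 0 := fun p x => by
    have := x.2
    rw [Submodule.mem_torsionBy_iff, Nat.cast_smul_eq_nsmul] at this
    ext
    exact this
  have hdec : ∀ p : ℕ, ∃ I : ℕ → Type u, p ∈ E.primeFactors →
      Nonempty (Submodule.torsionBy ℤ G (q p) ≃+
        ⨁ i : Finset.Icc 1 (E.factorization p), (I i →₀ ZMod (p ^ (i : ℕ)))) := by
    intro p
    by_cases hp : p ∈ E.primeFactors
    · have : Fact p.Prime := ⟨Nat.prime_of_mem_primeFactors hp⟩
      obtain ⟨I, hI⟩ := exists_addEquiv_directSum_finsupp (p := p) _ _ (htors p)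
      exact ⟨I, fun _ => hI⟩
    · exact ⟨fun _ => PUnit, fun h => absurd h hp⟩
  choose I hI using hdec
  refine ⟨⟨E.primeFactors, fun p hp => Nat.prime_of_mem_primeFactors hp, E.factorization,
    fun p hp => ?_, I, fun p hp => ?_, ?_⟩⟩
  · exact (Nat.prime_of_mem_primeFactors hp).factorization_pos_of_dvd hE
      (Nat.dvd_of_mem_primeFactors hp)
  -- If the top block were empty, `E / p` would already annihilate `G`, against minimality of the
  -- exponent.
  · by_contra hempty
    rw [not_nonempty_iff] at hempty
    have hpp := Nat.prime_of_mem_primeFactors hp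
    obtain ⟨d, hd⟩ := Nat.ordProj_dvd E p
    have hv := hpp.factorization_pos_of_dvd hE (Nat.dvd_of_mem_primeFactors hp)
    obtain ⟨e⟩ := hI p hp
    have hkill : ∀ x : Submodule.torsionBy ℤ G (q p), p ^ (E.factorization p - 1) • x = 0 :=
      fun x => e.injective (by
        rw [map_nsmul, pow_pred_nsmul_eq_zero_of_isEmpty hempty, map_zero])
    have hall : ∀ x : G, (p ^ (E.factorization p - 1) * d) • x = 0 := fun x => by
      have hx : d • x ∈ Submodule.torsionBy ℤ G (q p) := by
        rw [Submodule.mem_torsionBy_iff, Nat.cast_smul_eq_nsmul, ← mul_smul, ← hd]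
        exact AddMonoid.exponent_nsmul_eq_zero x
      have := congr(Subtype.val $(hkill ⟨d • x, hx⟩))
      rw [mul_smul]
      exact this
    have hdpos : 0 < d := Nat.pos_of_ne_zero fun h => hE (by rw [hd, h, mul_zero])
    have hle : E ≤ p ^ (E.factorization p - 1) * d :=
      AddMonoid.exponent_min' _ (Nat.mul_pos (pow_pos hpp.pos _) hdpos) hall
    have hlt : p ^ (E.factorization p - 1) * d < p ^ E.factorization p * d :=
      Nat.mul_lt_mul_of_pos_right (Nat.pow_lt_pow_right hpp.one_lt (by omega)) hdpos
    rw [← hd] at hlt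
    omega
  · exact (LinearEquiv.ofBijective (DirectSum.coeLinearMap _) hint).symm.toAddEquiv.trans
      (DFinsupp.mapRange.addEquiv fun p => (hI p p.2).some)

/-! ### The two implications. -/

theorem admitsMinAPTopology_directSum_finsupp {p n : ℕ} (hp : p.Prime) (hn : 1 ≤ n)
    (I : ℕ → Type u) [Infinite (I n)] :
    AdmitsMinAPTopology (⨁ i : Finset.Icc 1 n, (I i →₀ ZMod (p ^ (i : ℕ)))) := by
  classical
  have : Fact p.Prime := ⟨hp⟩
  refine AdmitsMinAPTopology.of_addEquiv ?_ (DirectSum.addEquivProd _).symm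
  let β : Finset.Icc 1 n → Type u := fun i => I i →₀ ZMod (p ^ (i : ℕ))
  let t : Finset.Icc 1 n := ⟨n, Finset.mem_Icc.2 ⟨hn, le_rfl⟩⟩
  -- The finite blocks form `F`, which is paired with the top block; the other infinite blocks carry
  -- their own topologies.
  let T : Set (Finset.Icc 1 n) := {i | Infinite (I i)}
  let F := ∀ i : {i // i ∉ T}, β i
  have : Finite F := by
    have : ∀ i : {i // i ∉ T}, Finite (β i) := fun i => by
      have : Finite (I i) := not_infinite_iff_finite.1 i.2
      exact .of_injective _ DFunLike.coe_injective
    infer_instance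
  let _ : Module (ZMod (p ^ n)) F := AddCommGroup.zmodModule fun x => by
    ext i j
    have h : p ^ (i : ℕ) ∣ p ^ n := pow_dvd_pow _ (Finset.mem_Icc.1 i.1.2).2
    change p ^ n • (x i j : ZMod (p ^ (i : ℕ))) = 0
    rw [nsmul_eq_mul, (ZMod.natCast_eq_zero_iff _ _).2 h, zero_mul]
  have h1 : AdmitsMinAPTopology (F × (I n →₀ ZMod (p ^ n))) :=
    admitsMinAPTopology_finite_prod_finsupp
  have h2 : AdmitsMinAPTopology (∀ i : {i : {i // i ∈ T} // (i : Finset.Icc 1 n) ≠ t}, β i) :=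
    .pi fun i => by
      have : Infinite (I i) := i.1.2
      exact admitsMinAPTopology_finsupp (pow_pos hp.pos (i : ℕ)) fun x => by
        rw [nsmul_eq_mul, ZMod.natCast_self, zero_mul]
  refine (h1.prod h2).of_addEquiv (AddEquiv.symm (AddEquiv.ofBijective
    (AddMonoidHom.prod (AddMonoidHom.prod
      (AddMonoidHom.mk' (fun x : ∀ i, β i => fun i : {i // i ∉ T} => x i) fun _ _ => rfl)
      (AddMonoidHom.mk' (fun x : ∀ i, β i => x t) fun _ _ => rfl))
      (AddMonoidHom.mk' (fun x : ∀ i, β i =>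
        fun i : {i : {i // i ∈ T} // (i : Finset.Icc 1 n) ≠ t} => x i) fun _ _ => rfl)) ⟨?_, ?_⟩))
  · intro x y h
    funext i
    by_cases hi : i ∈ T
    · by_cases hit : i = t
      · subst hit
        exact congr(($h).1.2)
      · exact congr_fun congr(($h).2) ⟨⟨i, hi⟩, hit⟩
    · exact congr_fun congr(($h).1.1) ⟨i, hi⟩
  · rintro ⟨⟨f, y⟩, z⟩
    have htT : t ∈ T := ‹Infinite (I n)›
    refine ⟨fun i => if hi : i ∈ T then
      if hit : i = t then hit ▸ y else z ⟨⟨i, hi⟩, hit⟩ else f ⟨i, hi⟩, ?_⟩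
    refine Prod.ext (Prod.ext (funext fun i => ?_) ?_) (funext fun i => ?_)
    · exact dif_neg i.2
    · exact (dif_pos htT).trans (dif_pos rfl)
    · exact (dif_pos i.1.2).trans (dif_neg i.2)

theorem AdmitsMinAPTopology.of_cyclicDecomposition {G : Type u} [AddCommGroup G]
    (D : CyclicDecomposition G) (h : ∀ p ∈ D.M, Infinite (D.I p (D.n p))) :
    AdmitsMinAPTopology G := by
  classical
  refine AdmitsMinAPTopology.of_addEquiv (G := ∀ p : D.M,
    ⨁ i : Finset.Icc 1 (D.n p), (D.I p i →₀ ZMod ((p : ℕ) ^ (i : ℕ)))) ?_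
    (D.equiv.trans (DirectSum.addEquivProd _)).symm
  refine .pi fun p => ?_
  have := h p p.2
  exact admitsMinAPTopology_directSum_finsupp (D.prime p p.2) (D.one_le_n p p.2) _

/-- A group with a minimally almost periodic topology has no nontrivial finite multiples. -/
theorem AdmitsMinAPTopology.nsmul_eq_zero_of_finite {G : Type u} [AddCommGroup G]
    (h : AdmitsMinAPTopology G) (m : ℕ) (hm : (Set.range fun x : G => m • x).Finite) (x : G) :
    m • x = 0 := by
  obtain ⟨_, _, _, hG⟩ := h
  rw [isMinAP_iff] at hG
  by_contra hx
  let R : AddSubgroup G := (nsmulAddMonoidHom (α := G) m).range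
  have : Finite R := hm
  have hne : (⟨m • x, x, rfl⟩ : R) ≠ 0 := fun h => hx congr(Subtype.val $h)
  obtain ⟨ψ, hψ⟩ := AddChar.exists_apply_ne_zero.2 hne
  let χ : AddChar R Circle := AddChar.circleEquivComplex.symm ψ
  have hχ : ψ = AddChar.circleEquivComplex χ := by simp [χ]
  -- `R` is finite and Hausdorff, hence discrete, so any character of it is continuous.
  have hcont : Continuous (nsmulAddMonoidHom (α := G) m).rangeRestrict :=
    (continuous_nsmul m).subtype_mk _
  have h1 := hG (χ.compAddMonoidHom (nsmulAddMonoidHom (α := G) m).rangeRestrict)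
    ((continuous_of_discreteTopology (f := χ)).comp hcont) x
  refine hψ ?_
  rw [hχ]
  exact congr(($h1 : ℂ)).trans Circle.coe_one

theorem CyclicDecomposition.infinite_of_admitsMinAPTopology {G : Type u} [AddCommGroup G]
    (D : CyclicDecomposition G) (h : AdmitsMinAPTopology G) {p : ℕ} (hp : p ∈ D.M) :
    Infinite (D.I p (D.n p)) := by
  classical
  by_contra hfin
  rw [not_infinite_iff_finite] at hfin
  replace h := h.of_addEquiv (H := ∀ p : D.M, ⨁ i : Finset.Icc 1 (D.n p),
    (D.I p i →₀ ZMod ((p : ℕ) ^ (i : ℕ)))) (D.equiv.trans (DirectSum.addEquivProd _))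
  have hpp := D.prime p hp
  have hn := D.one_le_n p hp
  let r : ℕ := ∏ q ∈ D.M.erase p, q ^ D.n q
  -- Chosen to kill every block except the top one at `p`, which it does not kill because `p ∤ r`.
  let m : ℕ := p ^ (D.n p - 1) * r
  have hr : ¬ p ∣ r := fun hdvd => by
    obtain ⟨q, hq, hpq⟩ := (hpp.prime.dvd_finsetProd_iff _).1 hdvd
    obtain ⟨hqp, hqM⟩ := Finset.mem_erase.1 hq
    exact hqp ((Nat.prime_dvd_prime_iff_eq hpp (D.prime q hqM)).1 (hpp.dvd_of_dvd_pow hpq)).symm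
  let t : Finset.Icc 1 (D.n p) := ⟨D.n p, Finset.mem_Icc.2 ⟨hn, le_rfl⟩⟩
  have hzero : ∀ (x : ∀ p : D.M, ⨁ i : Finset.Icc 1 (D.n p), (D.I p i →₀ ZMod ((p : ℕ) ^ (i : ℕ))))
      (q : D.M) (i : Finset.Icc 1 (D.n q)), ((q : ℕ) = p → (i : ℕ) ≠ D.n p) →
      m • x q i = 0 := by
    intro x q i hqi
    ext j
    have hdvd : (q : ℕ) ^ (i : ℕ) ∣ m := by
      have hi := (Finset.mem_Icc.1 i.2).2
      by_cases hqp : (q : ℕ) = p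
      · have := hqi hqp
        have hi' : (i : ℕ) ≤ D.n p := hi.trans_eq (congrArg D.n hqp)
        exact (dvd_of_eq (congrArg (· ^ (i : ℕ)) hqp)).trans
          ((pow_dvd_pow _ (by omega)).mul_right _)
      · exact ((pow_dvd_pow _ hi).trans (Finset.dvd_prod_of_mem (fun q => q ^ D.n q)
          (Finset.mem_erase.2 ⟨hqp, q.2⟩))).mul_left _
    change m • (x q i j : ZMod ((q : ℕ) ^ (i : ℕ))) = 0
    rw [nsmul_eq_mul, (ZMod.natCast_eq_zero_iff _ _).2 hdvd, zero_mul]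
  have hfinite : (Set.range fun x : ∀ p : D.M, ⨁ i : Finset.Icc 1 (D.n p),
      (D.I p i →₀ ZMod ((p : ℕ) ^ (i : ℕ))) => m • x).Finite := by
    have : NeZero p := ⟨hpp.ne_zero⟩
    have : Finite (D.I p (D.n p) →₀ ZMod (p ^ D.n p)) := .of_injective _ DFunLike.coe_injective
    refine Set.Finite.of_injOn (f := fun x => (x ⟨p, hp⟩ t : D.I p (D.n p) →₀ ZMod (p ^ D.n p)))
      (Set.mapsTo_univ _ _) ?_ Set.finite_univ
    rintro _ ⟨x, rfl⟩ _ ⟨y, rfl⟩ hxy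
    refine funext fun q => DFinsupp.ext fun i => ?_
    by_cases hqi : (q : ℕ) = p ∧ (i : ℕ) = D.n p
    · obtain ⟨q, hq⟩ := q
      obtain ⟨i, hi⟩ := i
      obtain ⟨rfl, rfl⟩ := hqi
      exact hxy
    · have hqi : (q : ℕ) = p → (i : ℕ) ≠ D.n p := fun h1 h2 => hqi ⟨h1, h2⟩
      exact (hzero x q i hqi).trans (hzero y q i hqi).symm
  obtain ⟨j⟩ := D.nonempty_top p hp
  let y : ⨁ i : Finset.Icc 1 (D.n p), (D.I p i →₀ ZMod (p ^ (i : ℕ))) :=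
    DirectSum.of (fun i : Finset.Icc 1 (D.n p) => (D.I p i →₀ ZMod (p ^ (i : ℕ)))) t
      (Finsupp.single j 1)
  let x : ∀ q : D.M, ⨁ i : Finset.Icc 1 (D.n q), (D.I q i →₀ ZMod ((q : ℕ) ^ (i : ℕ))) :=
    Pi.single ⟨p, hp⟩ y
  have h2 : m • (1 : ZMod (p ^ D.n p)) = 0 := by
    have h1 := h.nsmul_eq_zero_of_finite m hfinite x
    have hxy : x ⟨p, hp⟩ = y := Pi.single_eq_same _ _
    have h3 : m • y = 0 := hxy ▸ congr_fun h1 ⟨p, hp⟩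
    have h4 : m • (y t j : ZMod (p ^ D.n p)) = 0 := congr(($h3 t) j)
    rwa [DirectSum.of_eq_same, Finsupp.single_eq_same] at h4
  rw [nsmul_eq_mul, mul_one, ZMod.natCast_eq_zero_iff] at h2
  have h4 : p ^ (D.n p - 1) * p ∣ p ^ (D.n p - 1) * r := by
    rwa [← pow_succ, Nat.sub_add_cancel hn]
  exact hr (Nat.dvd_of_mul_dvd_mul_left (pow_pos hpp.pos _) h4)

theorem theorem3 (G : Type u) [AddCommGroup G] [Infinite G] (hG : AddMonoid.ExponentExists G) :
    AdmitsMinAPTopology G ↔ ∀ κ ∈ leadingUlmKaplanskyInvariants G, Cardinal.aleph0 ≤ κ := by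
  refine ⟨?_, fun h => ?_⟩
  · rintro h _ ⟨D, p, hp, rfl⟩
    exact Cardinal.infinite_iff.1 (D.infinite_of_admitsMinAPTopology h hp)
  · obtain ⟨D⟩ := nonempty_cyclicDecomposition hG
    exact .of_cyclicDecomposition D fun p hp => Cardinal.infinite_iff.2 (h _ ⟨D, p, hp, rfl⟩)
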